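/- **Proposition 5.5.** Let $(X,\lhd)$ be a quandle: $a\lhd a=a$, every map $\bullet\lhd a$ is bijective, and $(a\lhd b)\lhd c=(a\lhd c)\lhd(b\lhd c)$. Let $\mathrm{As}(X)=\langle e_x\ (x\in X)\mid e_{x\lhd y}^{-1}e_y^{-1}e_xe_y\ (x,y\in X)\rangle$ be its adjoint group, acting on $X$ from the right by $x\cdot e_y=x\lhd y$. Assume that $X$ is connected, i.e. this action has exactly one orbit, and that $X$ is of finite type $t_X$, i.e. $t_X\ge 1$ is the least positive integer $N$ such that $(\cdots((x\lhd y)\lhd y)\cdots)\lhd y=x$ ($N$ operations by $y$) for all $x,y\in X$; $X$ may be infinite. Fix $a\in X$, let $\varepsilon:\mathrm{As}(X)\to\mathbb Z$ be the homomorphism with $\varepsilon(e_x)=1$ for all $x\in X$, and let $\widetilde X$ be the quandle with underlying set $\mathrm{Ker}(\varepsilon)$ and operation $g\lhd h=e_a^{-1}gh^{-1}e_ah$. Let $p:\widetilde X\to X$, $p(g)=a\cdot g$, be the universal covering, and let $p_*:\mathrm{As}(\widetilde X)\to\mathrm{As}(X)$, $e_g\mapsto e_{p(g)}$, be the induced homomorphism.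 Then the map $$p_*:H_3^{\mathrm{gr}}(\mathrm{As}(\widetilde X))\longrightarrow H_3^{\mathrm{gr}}(\mathrm{As}(X))$$ induced on group homology with trivial integral coefficients is a $[1/t_X]$-isomorphism; that is, for every prime $\ell$ not dividing $t_X$, its localization at $\ell$ (at the prime ideal $(\ell)$ of $\mathbb Z$) is an isomorphism. -/

import Mathlib

open Quandles

noncomputable section

universe u v

/-!
Conventions.  A quandle in the right-handed convention is a set with a binary operation
`x ⊲ y` such that `a ⊲ a = a`, every map `x ↦ x ⊲ a` is bijective, and
`(a ⊲ b) ⊲ c = (a ⊲ c) ⊲ (b ⊲ c)`.  Under the dictionary `x ⊲ y = y ◃ x` these are exactly the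
axioms of Mathlib's class `Quandle`, and right-handed quandle homomorphisms are exactly Mathlib's
`X →◃ Y`.  The dictionary is used throughout.  The adjoint group below uses the right-handed
relations `e_{x ⊲ y} = e_y⁻¹ e_x e_y` (Mathlib's `Rack.EnvelGroup` is the opposite group).
-/

namespace QuandleCovering

/-- The right-handed quandle operation `x ⊲ y`. -/
def lhd {X : Type u} [Quandle X] (x y : X) : X := y ◃ x

/-- `X` is of type `t`: `t` is the least positive `N` such that
`(⋯((x ⊲ y) ⊲ y)⋯) ⊲ y = x` (`N` times) for all `x, y`. -/
def IsOfType (X : Type u) [Quandle X] (t : ℕ) : Prop :=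
  IsLeast {N : ℕ | 0 < N ∧ ∀ x y : X, (fun z => lhd z y)^[N] x = x} t

/-- The relators `e_{x ⊲ y}⁻¹ e_y⁻¹ e_x e_y` of the adjoint group. -/
def adjointRels (X : Type u) [Quandle X] : Set (FreeGroup X) :=
  Set.range fun q : X × X =>
    (FreeGroup.of (lhd q.1 q.2))⁻¹ * (FreeGroup.of q.2)⁻¹ * FreeGroup.of q.1 * FreeGroup.of q.2

/-- The adjoint group `As(X) = ⟨ e_x (x ∈ X) | e_{x ⊲ y}⁻¹ e_y⁻¹ e_x e_y (x, y ∈ X) ⟩`. -/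
abbrev As (X : Type u) [Quandle X] : Type u := PresentedGroup (adjointRels X)

/-- The generator `e_x` of `As(X)`. -/
def As.e {X : Type u} [Quandle X] (x : X) : As X := PresentedGroup.of x

theorem As.e_lhd {X : Type u} [Quandle X] (x y : X) :
    As.e (lhd x y) = (As.e y)⁻¹ * As.e x * As.e y := by
  have h : (As.e (lhd x y))⁻¹ * (As.e y)⁻¹ * As.e x * As.e y = 1 :=
    PresentedGroup.one_of_mem (rels := adjointRels X) ⟨(x, y), rfl⟩
  rw [mul_assoc, mul_assoc, inv_mul_eq_one, ← mul_assoc] at h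
  exact h

/-- A map `f : X → G` into a group with `f (x ⊲ y) = (f y)⁻¹ (f x) (f y)` extends to `As(X)`. -/
def As.lift {X : Type u} [Quandle X] {G : Type v} [Group G] (f : X → G)
    (hf : ∀ x y, f (lhd x y) = (f y)⁻¹ * f x * f y) : As X →* G :=
  PresentedGroup.toGroup (f := f) (by
    rintro _ ⟨⟨x, y⟩, rfl⟩
    simp [hf, mul_assoc])

@[simp]
theorem As.lift_e {X : Type u} [Quandle X] {G : Type v} [Group G] (f : X → G)
    (hf : ∀ x y, f (lhd x y) = (f y)⁻¹ * f x * f y) (x : X) : As.lift f hf (As.e x) = f x :=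
  PresentedGroup.toGroup.of _

/-- The homomorphism `As(X) → As(Y)`, `e_x ↦ e_{f x}`, induced by a quandle homomorphism. -/
def As.map {X : Type u} {Y : Type v} [Quandle X] [Quandle Y] (f : X →◃ Y) : As X →* As Y :=
  As.lift (fun x => As.e (f x)) (fun x y => by
    rw [← As.e_lhd]
    exact congrArg As.e (ShelfHom.map_act f))

/-- The right action of `As(X)` on `X`, as a homomorphism to the opposite of the symmetric group
(whose product is "first the left factor, then the right one"). -/
def As.perm (X : Type u) [Quandle X] : As X →* (Equiv.Perm X)ᵐᵒᵖ :=
  As.lift (fun y => MulOpposite.op (Rack.act' y)) (fun x y => by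
    rw [lhd, Rack.ad_conj, ← MulOpposite.op_inv, ← MulOpposite.op_mul, ← MulOpposite.op_mul,
      mul_assoc])

/-- The right action `x · g` of `g ∈ As(X)` on `x ∈ X`, determined by `x · e_y = x ⊲ y`. -/
def ract {X : Type u} [Quandle X] (x : X) (g : As X) : X := (As.perm X g).unop x

@[simp]
theorem ract_e {X : Type u} [Quandle X] (x y : X) : ract x (As.e y) = lhd x y := by
  simp [ract, As.perm, lhd]

@[simp]
theorem ract_one {X : Type u} [Quandle X] (x : X) : ract x 1 = x := by
  simp [ract]

theorem ract_mul {X : Type u} [Quandle X] (x : X) (g h : As X) :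
    ract x (g * h) = ract (ract x g) h := by
  simp [ract]

/-- `X` is connected: the right action of `As(X)` on `X` has exactly one orbit. -/
def IsConnected (X : Type u) [Quandle X] : Prop :=
  Nonempty X ∧ ∀ x y : X, ∃ g : As X, ract x g = y

/-- The homomorphism `ε : As(X) → ℤ` with `ε(e_x) = 1` for all `x ∈ X`
(for connected `X` it is the abelianization). -/
def As.eps (X : Type u) [Quandle X] : As X →* Multiplicative ℤ :=
  As.lift (fun _ => Multiplicative.ofAdd 1) (fun _ _ => by simp)

theorem As.eps_e {X : Type u} [Quandle X] (x : X) :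
    As.eps X (As.e x) = Multiplicative.ofAdd 1 := by
  simp [As.eps]

/-- The identity `e_{x · g} = g⁻¹ e_x g`. -/
theorem As.e_ract {X : Type u} [Quandle X] (g : As X) :
    ∀ x : X, As.e (ract x g) = g⁻¹ * As.e x * g := by
  induction g using PresentedGroup.induction_on with
  | _ w =>
    induction w using FreeGroup.induction_on with
    | C1 =>
      intro x
      rw [map_one, ract_one]
      simp
    | of y =>
      intro x
      exact (congrArg As.e (ract_e x y)).trans (As.e_lhd x y)
    | inv_of y ih =>
      intro x
      rw [map_inv]
      have h := ih (ract x (PresentedGroup.mk _ (FreeGroup.of y))⁻¹)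
      rw [← ract_mul, inv_mul_cancel, ract_one] at h
      rw [h]
      group
    | mul w z ihw ihz =>
      intro x
      rw [map_mul, ract_mul, ihz, ihw]
      group

/-- The underlying set `Ker(ε) ⊆ As(X)` of the extended quandle `X̃` with base point `a ∈ X`.
The base point enters the quandle operation. -/
@[nolint unusedArguments]
def UnivCover (X : Type u) [Quandle X] (_a : X) : Type u := (As.eps X).ker

namespace UnivCover

variable {X : Type u} [Quandle X] {a : X}

/-- The element of `As(X)` underlying an element of `X̃`. -/
def val (g : UnivCover X a) : As X := Subtype.val g

theorem ext {g h : UnivCover X a} (H : val g = val h) : g = h := Subtype.ext H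

theorem eps_val (g : UnivCover X a) : As.eps X g.val = 1 := Subtype.property g

/-- The quandle operation `g ⊲ h = e_a⁻¹ g h⁻¹ e_a h` on `X̃ = Ker(ε)`. -/
def op (g h : UnivCover X a) : UnivCover X a :=
  ⟨(As.e a)⁻¹ * g.val * h.val⁻¹ * As.e a * h.val, by
    simp [MonoidHom.mem_ker, eps_val, As.eps_e]⟩

/-- The inverse of `(• ⊲ h)`: the map `g ↦ e_a g h⁻¹ e_a⁻¹ h`. -/
def invOp (g h : UnivCover X a) : UnivCover X a :=
  ⟨As.e a * g.val * h.val⁻¹ * (As.e a)⁻¹ * h.val, by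
    simp [MonoidHom.mem_ker, eps_val, As.eps_e]⟩

theorem val_op (g h : UnivCover X a) :
    (op g h).val = (As.e a)⁻¹ * g.val * h.val⁻¹ * As.e a * h.val := rfl

theorem val_invOp (g h : UnivCover X a) :
    (invOp g h).val = As.e a * g.val * h.val⁻¹ * (As.e a)⁻¹ * h.val := rfl

/-- The extended quandle `X̃` (recall that `h ◃ g` stands for `g ⊲ h`). -/
instance : Quandle (UnivCover X a) where
  act h g := op g h
  self_distrib {x y z} := ext (by simp only [val_op]; group)
  invAct h g := invOp g h
  left_inv h g := ext (by simp only [val_op, val_invOp]; group)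
  right_inv h g := ext (by simp only [val_op, val_invOp]; group)
  fix {g} := ext (by simp only [val_op]; group)

variable (X a)

/-- The universal covering `p : X̃ → X`, `p(g) = a · g`. -/
def proj : UnivCover X a →◃ X where
  toFun g := ract a g.val
  map_act' {h g} := by
    have h1 : ract a (As.e a)⁻¹ = a := by
      have h2 : ract a (As.e a) = a := by rw [ract_e, lhd, Quandle.fix]
      calc ract a (As.e a)⁻¹ = ract (ract a (As.e a)) (As.e a)⁻¹ := by rw [h2]
        _ = a := by rw [← ract_mul, mul_inv_cancel, ract_one]
    have h3 : (op g h).val = (As.e a)⁻¹ * (g.val * As.e (ract a h.val)) := by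
      rw [val_op, As.e_ract]
      group
    change ract a (op g h).val = lhd (ract a g.val) (ract a h.val)
    rw [h3, ract_mul, h1, ract_mul, ract_e]

end UnivCover

/-- The integers in the universe `u`. -/
abbrev IntU : Type u := ULift.{u} ℤ

/-- The group homology `H_n(G)` with trivial integral coefficients.  (Mathlib's `groupHomology`
wants the coefficient ring in the universe of the group.) -/
abbrev H (n : ℕ) (G : Type u) [Group G] : Type u :=
  groupHomology (Rep.trivial IntU.{u} G IntU.{u}) n

/-- The identity of the coefficients, as a map of representations over `f : G → G'`. -/
def coeffMap {G G' : Type u} [Group G] [Group G'] (f : G →* G') :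
    Rep.trivial IntU.{u} G IntU.{u} ⟶ Rep.res f (Rep.trivial IntU.{u} G' IntU.{u}) :=
  Rep.ofHom ⟨LinearMap.id, fun _ => rfl⟩

/-- The homomorphism `f_* : H_n(G) → H_n(G')` induced by a group homomorphism `f : G → G'`. -/
def H.map (n : ℕ) {G G' : Type u} [Group G] [Group G'] (f : G →* G') : H n G →+ H n G' :=
  (groupHomology.map f (coeffMap f) n).hom.toAddMonoidHom

instance isPrime_span (ℓ : ℕ) [hℓ : Fact ℓ.Prime] : (Ideal.span {(ℓ : ℤ)}).IsPrime :=
  (Ideal.span_singleton_prime (by exact_mod_cast hℓ.out.ne_zero)).2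
    (Nat.prime_iff_prime_int.1 hℓ.out)

/-- A homomorphism `f : A → B` of abelian groups is a `[1/N]`-isomorphism if for every prime `ℓ`
not dividing `N` its localization at `ℓ` (that is, at the prime ideal `(ℓ)` of `ℤ`) is an
isomorphism. -/
def IsAwayIso (N : ℕ) {A : Type u} {B : Type v} [AddCommGroup A] [AddCommGroup B]
    (f : A →+ B) : Prop :=
  ∀ (ℓ : ℕ) [Fact ℓ.Prime], ¬ ℓ ∣ N →
    Function.Bijective
      (LocalizedModule.map (Ideal.span {(ℓ : ℤ)}).primeCompl f.toIntLinearMap)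

end QuandleCovering

end

open Quandles

noncomputable section

universe u v

/-! The map p_* is a surjection with central kernel of exponent t (`map_proj_surjective`,
`ker_map_proj_le_center`, `pow_eq_one_of_mem_ker`), and every such extension is a [1/t]-isomorphism
on H₃ (`isAwayIso_H3_of_central`).

Kernel: As(X̃) acts on X̃ by x · g = e_a^{-ε(g)} x p_*(g), so the kernel acts trivially and is
therefore central. All the e_g^t coincide, being central and conjugate; hence two generators over
the same point of X differ by a kernel element whose t-th power is 1. Modulo such elements p_*
becomes invertible, so they exhaust the kernel.

Homology: the kernel may be infinite, but a chain involves only finitely many of its elements, and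
these lie in a finite central subgroup B of order prime to ℓ. Averaging every bar entry over B is,
up to powers of |B| and in the degrees needed, a chain map homotopic to the identity
(`barD_transfer3`, `barD_homotopy3`), and it sees entries only modulo B. A set-theoretic section of
the extension thus becomes good enough to lift cycles and boundaries. -/

namespace QuandleCovering

open groupHomology

/-! ### The bar complex with entries in the group algebra -/

section Bar

variable (k : Type u) [CommRing k] {G : Type u} [Group G]

/-- The differential of the inhomogeneous bar complex of `G` with trivial coefficients `k`. -/
def barD (G : Type u) [Group G] (n : ℕ) : ((Fin (n + 1) → G) →₀ k) →ₗ[k] ((Fin n → G) →₀ k) :=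
  (inhomogeneousChains.d (Rep.trivial k G k) n).hom

theorem barD_single (n : ℕ) (g : Fin (n + 1) → G) (r : k) :
    barD k G n (Finsupp.single g r) = Finsupp.single (fun i => g i.succ) r +
      Finset.univ.sum fun j : Fin (n + 1) =>
        (-1 : k) ^ ((j : ℕ) + 1) • Finsupp.single (Fin.contractNth j (· * ·) g) r :=
  inhomogeneousChains.d_single (A := Rep.trivial k G k) n g r

theorem barD_three (x y z : G) :
    barD k G 2 (Finsupp.single ![x, y, z] 1) =
      Finsupp.single ![y, z] 1 - Finsupp.single ![x * y, z] 1 + Finsupp.single ![x, y * z] 1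
        - Finsupp.single ![x, y] 1 := by
  rw [barD_single, Fin.sum_univ_three]
  have h0 : (fun i : Fin 2 => ![x, y, z] i.succ) = ![y, z] := by
    ext i; fin_cases i <;> rfl
  have h1 : Fin.contractNth (0 : Fin 3) (· * ·) ![x, y, z] = ![x * y, z] := by
    ext i; fin_cases i <;> rfl
  have h2 : Fin.contractNth (1 : Fin 3) (· * ·) ![x, y, z] = ![x, y * z] := by
    ext i; fin_cases i <;> rfl
  have h3 : Fin.contractNth (2 : Fin 3) (· * ·) ![x, y, z] = ![x, y] := by
    ext i; fin_cases i <;> rfl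
  rw [h0, h1, h2, h3]
  norm_num
  abel

theorem barD_four (x y z w : G) :
    barD k G 3 (Finsupp.single ![x, y, z, w] 1) =
      Finsupp.single ![y, z, w] 1 - Finsupp.single ![x * y, z, w] 1
        + Finsupp.single ![x, y * z, w] 1 - Finsupp.single ![x, y, z * w] 1
        + Finsupp.single ![x, y, z] 1 := by
  rw [barD_single, Fin.sum_univ_four]
  have h0 : (fun i : Fin 3 => ![x, y, z, w] i.succ) = ![y, z, w] := by
    ext i; fin_cases i <;> rfl
  have h1 : Fin.contractNth (0 : Fin 4) (· * ·) ![x, y, z, w] = ![x * y, z, w] := by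
    ext i; fin_cases i <;> rfl
  have h2 : Fin.contractNth (1 : Fin 4) (· * ·) ![x, y, z, w] = ![x, y * z, w] := by
    ext i; fin_cases i <;> rfl
  have h3 : Fin.contractNth (2 : Fin 4) (· * ·) ![x, y, z, w] = ![x, y, z * w] := by
    ext i; fin_cases i <;> rfl
  have h4 : Fin.contractNth (3 : Fin 4) (· * ·) ![x, y, z, w] = ![x, y, z] := by
    ext i; fin_cases i <;> rfl
  rw [h0, h1, h2, h3, h4]
  norm_num
  abel

/-- The linear extension of `f : G → M` to the group algebra. -/
def linExt {M : Type v} [AddCommGroup M] [Module k M] (f : G → M) : MonoidAlgebra k G →ₗ[k] M :=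
  (MonoidAlgebra.basis G k).constr k f

@[simp]
theorem linExt_of {M : Type v} [AddCommGroup M] [Module k M] (f : G → M) (g : G) :
    linExt k f (MonoidAlgebra.of k G g) = f g := by
  have h := (MonoidAlgebra.basis G k).constr_basis k f g
  rwa [MonoidAlgebra.basis_apply] at h

/-- The bilinear extension of `(x, y) ↦ [x | y]`. -/
def bar2 : MonoidAlgebra k G →ₗ[k] MonoidAlgebra k G →ₗ[k] ((Fin 2 → G) →₀ k) :=
  linExt k fun x => linExt k fun y => Finsupp.single ![x, y] 1

/-- The trilinear extension of `(x, y, z) ↦ [x | y | z]`. -/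
def bar3 : MonoidAlgebra k G →ₗ[k] MonoidAlgebra k G →ₗ[k] MonoidAlgebra k G →ₗ[k]
    ((Fin 3 → G) →₀ k) :=
  linExt k fun x => linExt k fun y => linExt k fun z => Finsupp.single ![x, y, z] 1

/-- The quadrilinear extension of `(x, y, z, w) ↦ [x | y | z | w]`. -/
def bar4 : MonoidAlgebra k G →ₗ[k] MonoidAlgebra k G →ₗ[k] MonoidAlgebra k G →ₗ[k]
    MonoidAlgebra k G →ₗ[k] ((Fin 4 → G) →₀ k) :=
  linExt k fun x => linExt k fun y => linExt k fun z => linExt k fun w =>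
    Finsupp.single ![x, y, z, w] 1

/-- The augmentation of the group algebra. -/
def aug : MonoidAlgebra k G →ₗ[k] k := linExt k fun _ => 1

/-- Dropping an outer entry becomes, after linear extension, applying the augmentation. Both sides
are then trilinear, so group elements suffice. -/
theorem barD_bar3 (u v w : MonoidAlgebra k G) :
    barD k G 2 (bar3 k u v w) =
      aug k u • bar2 k v w - bar2 k (u * v) w + bar2 k u (v * w) - aug k w • bar2 k u v := by
  induction u using MonoidAlgebra.induction_on with
  | of x =>
    induction v using MonoidAlgebra.induction_on with
    | of y =>
      induction w using MonoidAlgebra.induction_on with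
      | of z =>
        simp only [← map_mul]
        simp only [aug, bar2, bar3, linExt_of, barD_three, one_smul]
      | add f g hf hg => simp only [map_add, mul_add, add_smul, smul_add, hf, hg]; abel
      | smul r f hf => simp only [map_smul, mul_smul_comm, smul_eq_mul, hf]; module
    | add f g hf hg =>
      simp only [map_add, mul_add, add_mul, smul_add, LinearMap.add_apply, hf, hg]; abel
    | smul r f hf =>
      simp only [map_smul, mul_smul_comm, smul_mul_assoc, LinearMap.smul_apply, hf]; module
  | add f g hf hg =>
    simp only [map_add, add_mul, add_smul, smul_add, LinearMap.add_apply, hf, hg]; abel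
  | smul r f hf =>
    simp only [map_smul, smul_mul_assoc, LinearMap.smul_apply, smul_eq_mul, hf]; module

theorem barD_bar4 (t u v w : MonoidAlgebra k G) :
    barD k G 3 (bar4 k t u v w) =
      aug k t • bar3 k u v w - bar3 k (t * u) v w + bar3 k t (u * v) w - bar3 k t u (v * w)
        + aug k w • bar3 k t u v := by
  induction t using MonoidAlgebra.induction_on with
  | of s =>
    induction u using MonoidAlgebra.induction_on with
    | of x =>
      induction v using MonoidAlgebra.induction_on with
      | of y =>
        induction w using MonoidAlgebra.induction_on with
        | of z =>
          simp only [← map_mul]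
          simp only [aug, bar4, bar3, linExt_of, barD_four, one_smul]
        | add f g hf hg => simp only [map_add, mul_add, add_smul, smul_add, hf, hg]; abel
        | smul r f hf => simp only [map_smul, mul_smul_comm, smul_eq_mul, hf]; module
      | add f g hf hg =>
        simp only [map_add, mul_add, add_mul, smul_add, LinearMap.add_apply, hf, hg]; abel
      | smul r f hf =>
        simp only [map_smul, mul_smul_comm, smul_mul_assoc, LinearMap.smul_apply, hf]; module
    | add f g hf hg =>
      simp only [map_add, mul_add, add_mul, smul_add, LinearMap.add_apply, hf, hg]; abel
    | smul r f hf =>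
      simp only [map_smul, mul_smul_comm, smul_mul_assoc, LinearMap.smul_apply, hf]; module
  | add f g hf hg =>
    simp only [map_add, add_mul, add_smul, smul_add, LinearMap.add_apply, hf, hg]; abel
  | smul r f hf =>
    simp only [map_smul, smul_mul_assoc, LinearMap.smul_apply, smul_eq_mul, hf]; module

/-! ### Averaging over a finite central subgroup -/

variable (B : Subgroup G) [Fintype B]

/-- The norm element `∑_{β ∈ B} β` of the group algebra. -/
def normElt : MonoidAlgebra k G := ∑ β : B, MonoidAlgebra.of k G β

theorem aug_normElt : aug k (normElt k B) = (Fintype.card B : k) := by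
  simp [aug, normElt, -MonoidAlgebra.of_apply]

theorem of_mul_normElt_of_mem {g : G} (hg : g ∈ B) :
    MonoidAlgebra.of k G g * normElt k B = normElt k B := by
  simp only [normElt, Finset.mul_sum, ← map_mul]
  exact Fintype.sum_equiv (Equiv.mulLeft (⟨g, hg⟩ : B)) _ _ fun _ => rfl

/-- This is why the transfers depend only on the cosets of the entries modulo B. -/
theorem of_mul_normElt_eq {x y : G} (h : x⁻¹ * y ∈ B) :
    MonoidAlgebra.of k G x * normElt k B = MonoidAlgebra.of k G y * normElt k B := by
  conv_lhs => rw [← of_mul_normElt_of_mem k B h]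
  rw [← mul_assoc, ← map_mul, mul_inv_cancel_left]

theorem normElt_mul_self :
    normElt k B * normElt k B = (Fintype.card B : k) • normElt k B := by
  conv_lhs => enter [1]; rw [normElt]
  rw [Finset.sum_mul, Finset.sum_congr rfl fun β _ => of_mul_normElt_of_mem k B β.2]
  simp [Nat.cast_smul_eq_nsmul]

variable {B}

theorem normElt_mul_of (hB : B ≤ Subgroup.center G) (g : G) :
    normElt k B * MonoidAlgebra.of k G g = MonoidAlgebra.of k G g * normElt k B := by
  simp only [normElt, Finset.mul_sum, Finset.sum_mul, ← map_mul]
  exact Finset.sum_congr rfl fun β _ => by rw [Subgroup.mem_center_iff.1 (hB β.2) g]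

variable (B)

/-- The map `[x | y] ↦ ∑ [xβ₁ | yβ₂]` of 2-chains. -/
def transfer2 : ((Fin 2 → G) →₀ k) →ₗ[k] ((Fin 2 → G) →₀ k) :=
  Finsupp.linearCombination k fun g =>
    bar2 k (MonoidAlgebra.of k G (g 0) * normElt k B) (MonoidAlgebra.of k G (g 1) * normElt k B)

/-- The map `[x | y | z] ↦ ∑ [xβ₁ | yβ₂ | zβ₃]` of 3-chains. -/
def transfer3 : ((Fin 3 → G) →₀ k) →ₗ[k] ((Fin 3 → G) →₀ k) :=
  Finsupp.linearCombination k fun g =>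
    bar3 k (MonoidAlgebra.of k G (g 0) * normElt k B) (MonoidAlgebra.of k G (g 1) * normElt k B)
      (MonoidAlgebra.of k G (g 2) * normElt k B)

/-- The degree two part of the homotopy between `transfer` and a multiple of the identity. -/
def homotopy2 : ((Fin 2 → G) →₀ k) →ₗ[k] ((Fin 3 → G) →₀ k) :=
  Finsupp.linearCombination k fun g =>
    (Fintype.card B : k) • bar3 k (normElt k B) (MonoidAlgebra.of k G (g 0) * normElt k B)
        (MonoidAlgebra.of k G (g 1) * normElt k B)
      - (Fintype.card B : k) ^ 2 • bar3 k (MonoidAlgebra.of k G (g 0)) (normElt k B)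
        (MonoidAlgebra.of k G (g 1) * normElt k B)
      + (Fintype.card B : k) ^ 3 • bar3 k (MonoidAlgebra.of k G (g 0))
        (MonoidAlgebra.of k G (g 1)) (normElt k B)

/-- The degree three part of the homotopy between `transfer` and a multiple of the identity. -/
def homotopy3 : ((Fin 3 → G) →₀ k) →ₗ[k] ((Fin 4 → G) →₀ k) :=
  Finsupp.linearCombination k fun g =>
    bar4 k (normElt k B) (MonoidAlgebra.of k G (g 0) * normElt k B)
        (MonoidAlgebra.of k G (g 1) * normElt k B) (MonoidAlgebra.of k G (g 2) * normElt k B)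
      - (Fintype.card B : k) • bar4 k (MonoidAlgebra.of k G (g 0)) (normElt k B)
        (MonoidAlgebra.of k G (g 1) * normElt k B) (MonoidAlgebra.of k G (g 2) * normElt k B)
      + (Fintype.card B : k) ^ 2 • bar4 k (MonoidAlgebra.of k G (g 0))
        (MonoidAlgebra.of k G (g 1)) (normElt k B) (MonoidAlgebra.of k G (g 2) * normElt k B)
      - (Fintype.card B : k) ^ 3 • bar4 k (MonoidAlgebra.of k G (g 0))
        (MonoidAlgebra.of k G (g 1)) (MonoidAlgebra.of k G (g 2)) (normElt k B)

variable {B}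

theorem aug_of_mul_normElt (g : G) :
    aug k (MonoidAlgebra.of k G g * normElt k B) = (Fintype.card B : k) := by
  simp only [normElt, Finset.mul_sum, ← map_mul]
  simp only [map_sum, aug, linExt_of]
  simp

theorem of_mul_normElt_mul (hB : B ≤ Subgroup.center G) (x y : G) :
    MonoidAlgebra.of k G x * normElt k B * (MonoidAlgebra.of k G y * normElt k B) =
      (Fintype.card B : k) • (MonoidAlgebra.of k G (x * y) * normElt k B) := by
  rw [mul_assoc, ← mul_assoc (normElt k B), normElt_mul_of k hB, mul_assoc, normElt_mul_self,
    ← mul_assoc, ← map_mul, mul_smul_comm]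

theorem normElt_mul_of_mul_normElt (hB : B ≤ Subgroup.center G) (x : G) :
    normElt k B * (MonoidAlgebra.of k G x * normElt k B) =
      (Fintype.card B : k) • (MonoidAlgebra.of k G x * normElt k B) := by
  rw [← mul_assoc, normElt_mul_of k hB, mul_assoc, normElt_mul_self, mul_smul_comm]

theorem aug_of (g : G) : aug k (MonoidAlgebra.of k G g) = 1 := linExt_of k _ g

theorem chain3_induction {α : Type v} {P : ((Fin 3 → α) →₀ k) → Prop} (c : (Fin 3 → α) →₀ k)
    (zero : P 0) (add : ∀ c d, P c → P d → P (c + d)) (smul : ∀ (r : k) c, P c → P (r • c))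
    (single : ∀ x y z : α, P (Finsupp.single ![x, y, z] 1)) : P c := by
  induction c using Finsupp.induction_linear with
  | zero => exact zero
  | add c d hc hd => exact add c d hc hd
  | single g r =>
    have h := smul r _ (single (g 0) (g 1) (g 2))
    have hg : ![g 0, g 1, g 2] = g := by ext i; fin_cases i <;> rfl
    rwa [hg, Finsupp.smul_single, smul_eq_mul, mul_one] at h

/-- Each face yields one factor |B|: an outer face from the augmentation of the norm N, an inner one
from N * N = |B| N, with N central. -/
theorem barD_transfer3 (hB : B ≤ Subgroup.center G) (c : (Fin 3 → G) →₀ k) :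
    barD k G 2 (transfer3 k B c) = (Fintype.card B : k) • transfer2 k B (barD k G 2 c) := by
  induction c using chain3_induction k with
  | zero => simp
  | add c d hc hd => simp only [map_add, smul_add, hc, hd]
  | smul r c hc => simp only [map_smul, hc]; module
  | single x y z =>
    simp only [barD_three, map_add, map_sub, transfer3, transfer2,
      Finsupp.linearCombination_single, one_smul, Matrix.cons_val_zero, Matrix.cons_val_one,
      Matrix.cons_val, barD_bar3, aug_of_mul_normElt, of_mul_normElt_mul k hB, map_smul,
      LinearMap.smul_apply]
    module

/-- A prism operator: N is inserted at each position and the later entries are multiplied by N.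
Merging N with the entry on its right costs |B|, with the one on its left nothing; the growing
powers of |B| in `homotopy3` make these faces cancel between neighbouring terms. The extra factor
|B| in `homotopy2` matches the faces that lose one N. -/
theorem barD_homotopy3 (hB : B ≤ Subgroup.center G) (c : (Fin 3 → G) →₀ k) :
    barD k G 3 (homotopy3 k B c) + homotopy2 k B (barD k G 2 c) =
      (Fintype.card B : k) • transfer3 k B c - (Fintype.card B : k) ^ 4 • c := by
  induction c using chain3_induction k with
  | zero => simp
  | add c d hc hd => simp only [map_add, smul_add]; rw [add_add_add_comm, hc, hd]; abel
  | smul r c hc => simp only [map_smul]; rw [← smul_add, hc]; module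
  | single x y z =>
    have hs : Finsupp.single ![x, y, z] (1 : k) = bar3 k (MonoidAlgebra.of k G x)
        (MonoidAlgebra.of k G y) (MonoidAlgebra.of k G z) := by simp only [bar3, linExt_of]
    simp only [barD_three, map_add, map_sub, transfer3, homotopy2, homotopy3,
      Finsupp.linearCombination_single, one_smul, Matrix.cons_val_zero, Matrix.cons_val_one,
      Matrix.cons_val, barD_bar4, aug_of_mul_normElt, aug_normElt, aug_of,
      of_mul_normElt_mul k hB, normElt_mul_of_mul_normElt k hB, map_smul, LinearMap.smul_apply]
    simp only [← map_mul, hs]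
    module

end Bar

open CategoryTheory

/-! ### Chains under a surjection, and finite subgroups of its kernel -/

section Chains

variable (k : Type u) [CommRing k]

/-- The map of inhomogeneous chains induced by a map of sets. -/
def pushChain {G Q : Type u} (f : G → Q) (n : ℕ) : ((Fin n → G) →₀ k) →ₗ[k] ((Fin n → Q) →₀ k) :=
  Finsupp.lmapDomain k k (f ∘ ·)

theorem pushChain_single {G Q : Type u} (f : G → Q) (n : ℕ) (g : Fin n → G) (r : k) :
    pushChain k f n (Finsupp.single g r) = Finsupp.single (f ∘ g) r :=
  Finsupp.mapDomain_single

theorem pushChain_section {G Q : Type u} {f : G → Q} {s : Q → G} (hs : ∀ x, f (s x) = x) (n : ℕ)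
    (c : (Fin n → Q) →₀ k) : pushChain k f n (pushChain k s n c) = c := by
  induction c using Finsupp.induction_linear with
  | zero => simp
  | add c d hc hd => simp only [map_add, hc, hd]
  | single g r =>
    rw [pushChain_single, pushChain_single]
    congr 1
    ext i
    exact hs _

variable {G Q : Type u} [Group G] [Group Q]

theorem barD_pushChain (f : G →* Q) (n : ℕ) (c : (Fin (n + 1) → G) →₀ k) :
    barD k Q n (pushChain k f (n + 1) c) = pushChain k f n (barD k G n c) := by
  induction c using Finsupp.induction_linear with
  | zero => simp
  | add c d hc hd => simp only [map_add, hc, hd]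
  | single g r =>
    simp only [pushChain_single, barD_single, map_add, map_sum, map_smul, Fin.comp_contractNth,
      map_mul]
    rfl

/-- A chain which dies in `Q` is killed by every linear map that identifies simplices which differ
by elements of a suitable finite subset of the kernel. -/
theorem exists_finite_of_pushChain_eq_zero {f : G →* Q} (hf : Function.Surjective f) {n : ℕ}
    (c : (Fin n → G) →₀ k) (hc : pushChain k f n c = 0) :
    ∃ S : Set G, S.Finite ∧ S ⊆ f.ker ∧
      ∀ L : ((Fin n → G) →₀ k) →ₗ[k] ((Fin n → G) →₀ k),
        (∀ x y : Fin n → G, (∀ i, (x i)⁻¹ * y i ∈ S) →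
          L (Finsupp.single x 1) = L (Finsupp.single y 1)) → L c = 0 := by
  obtain ⟨s, hs⟩ := hf.hasRightInverse
  -- These elements move each simplex of `c` to the lift by `s` of its image, so `L` cannot tell `c`
  -- from the lift of its image, which is zero.
  refine ⟨⋃ x ∈ c.support, Set.range fun i => (x i)⁻¹ * s (f (x i)), ?_, ?_, ?_⟩
  · exact c.support.finite_toSet.biUnion fun x _ => Set.finite_range _
  · simp only [Set.iUnion_subset_iff]
    rintro x - _ ⟨i, rfl⟩
    simp [MonoidHom.mem_ker, hs (f (x i))]
  · intro L hL
    have hLr (x : Fin n → G) (r : k) :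
        L (Finsupp.single x r) = r • L (Finsupp.single x 1) := by
      rw [← map_smul, Finsupp.smul_single, smul_eq_mul, mul_one]
    have h : L c = L (pushChain k s n (pushChain k f n c)) := by
      conv_lhs => rw [← Finsupp.sum_single c]
      conv_rhs => rw [← Finsupp.sum_single c]
      simp only [Finsupp.sum, map_sum, pushChain_single]
      refine Finset.sum_congr rfl fun x hx => ?_
      rw [hLr, hLr (s ∘ f ∘ x)]
      congr 1
      exact hL _ _ fun i => Set.mem_biUnion hx ⟨i, rfl⟩
    rw [h, hc, map_zero, map_zero]

variable (B : Subgroup G) [Fintype B]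

theorem transfer2_single_eq {x y : Fin 2 → G} (h : ∀ i, (x i)⁻¹ * y i ∈ B) :
    transfer2 k B (Finsupp.single x 1) = transfer2 k B (Finsupp.single y 1) := by
  simp only [transfer2, Finsupp.linearCombination_single, of_mul_normElt_eq k B (h _)]

theorem transfer3_single_eq {x y : Fin 3 → G} (h : ∀ i, (x i)⁻¹ * y i ∈ B) :
    transfer3 k B (Finsupp.single x 1) = transfer3 k B (Finsupp.single y 1) := by
  simp only [transfer3, Finsupp.linearCombination_single, of_mul_normElt_eq k B (h _)]

theorem pushChain_transfer3 {f : G →* Q} (hB : B ≤ f.ker) (c : (Fin 3 → G) →₀ k) :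
    pushChain k f 3 (transfer3 k B c) = (Fintype.card B : k) ^ 3 • pushChain k f 3 c := by
  induction c using chain3_induction k with
  | zero => simp
  | add c d hc hd => simp only [map_add, smul_add, hc, hd]
  | smul r c hc => simp only [map_smul, hc]; module
  | single x y z =>
    have h (β : B) : f β = 1 := hB β.2
    have hp (x y z : G) : pushChain k f 3 (Finsupp.single ![x, y, z] 1) =
        Finsupp.single ![f x, f y, f z] 1 := by
      rw [pushChain_single]
      congr 1
      ext i; fin_cases i <;> rfl
    simp only [transfer3, Finsupp.linearCombination_single, one_smul, Matrix.cons_val_zero,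
      Matrix.cons_val_one, Matrix.cons_val, normElt, Finset.mul_sum, ← map_mul, map_sum,
      LinearMap.sum_apply, bar3, linExt_of, hp]
    simp only [map_mul, h, mul_one, Finset.sum_const, Finset.card_univ, smul_smul,
      ← Nat.cast_smul_eq_nsmul k]
    congr 1
    ring

/-- Every finite set of central elements of exponent `t` lies in a finite central subgroup of
order prime to `ℓ`. -/
theorem exists_finite_subgroup {A : Subgroup G} (hA : A ≤ Subgroup.center G) {t : ℕ} (ht : 0 < t)
    (hAt : ∀ c ∈ A, c ^ t = 1) {S : Set G} (hS : S.Finite) (hSA : S ⊆ A) :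
    ∃ B : Subgroup G, Finite B ∧ B ≤ A ∧ S ⊆ B ∧
      ∀ ℓ : ℕ, ℓ.Prime → ¬ ℓ ∣ t → ¬ ℓ ∣ Nat.card B := by
  have hB : Subgroup.closure S ≤ A := (Subgroup.closure_le A).2 hSA
  have hfin : Finite (Subgroup.closure S) := by
    let : CommGroup (Subgroup.closure S) :=
      { (inferInstance : Group (Subgroup.closure S)) with
        mul_comm := fun x y => Subtype.ext
          (Subgroup.mem_center_iff.1 (hA (hB y.2)) x) }
    have : Group.FG (Subgroup.closure S) :=
      (Group.fg_iff_subgroup_fg _).2 ((Subgroup.fg_iff _).2 ⟨S, rfl, hS⟩)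
    refine CommGroup.finite_of_fg_isMulTorsion _ fun x => ?_
    exact isOfFinOrder_iff_pow_eq_one.2 ⟨t, ht, Subtype.ext (hAt _ (hB x.2))⟩
  refine ⟨_, hfin, hB, Subgroup.subset_closure, fun ℓ hℓ hℓt hdvd => hℓt ?_⟩
  have := Fact.mk hℓ
  -- Cauchy: an element of order ℓ would force ℓ to divide the exponent t.
  obtain ⟨x, hx⟩ := exists_prime_orderOf_dvd_card' ℓ hdvd
  rw [← hx]
  exact orderOf_dvd_of_pow_eq_one (Subtype.ext (hAt _ (hB x.2)))

end Chains

/-! ### Lifting boundaries and cycles along a central extension -/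

section CentralExtension

variable (k : Type u) [CommRing k] {G Q : Type u} [Group G] [Group Q] {f : G →* Q}
  (hf : Function.Surjective f) (hc : f.ker ≤ Subgroup.center G) {t : ℕ} (ht : 0 < t)
  (hft : ∀ c ∈ f.ker, c ^ t = 1) {ℓ : ℕ} (hℓ : ℓ.Prime) (hℓt : ¬ ℓ ∣ t)

include hf hc ht hft hℓ hℓt

/-- Subtracting the boundary of a set-theoretic lift of `w` leaves a cycle that dies in Q. The
transfer kills it, so the homotopy bounds |B|⁴ times it. -/
theorem exists_smul_boundary (z : (Fin 3 → G) →₀ k) (hz : barD k G 2 z = 0)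
    (w : (Fin 4 → Q) →₀ k) (hw : barD k Q 3 w = pushChain k f 3 z) :
    ∃ m : ℕ, ¬ ℓ ∣ m ∧ ∃ v, barD k G 3 v = m • z := by
  obtain ⟨s, hs⟩ := hf.hasRightInverse
  have hker : pushChain k f 3 (z - barD k G 3 (pushChain k s 4 w)) = 0 := by
    rw [map_sub, ← barD_pushChain, pushChain_section k hs, hw, sub_self]
  obtain ⟨S, hS, hSA, hL⟩ := exists_finite_of_pushChain_eq_zero k hf _ hker
  obtain ⟨B, hB, hBA, hSB, hcard⟩ := exists_finite_subgroup hc ht hft hS hSA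
  have := Fintype.ofFinite B
  have hT := hL (transfer3 k B) fun x y h => transfer3_single_eq k B fun i => hSB (h i)
  have hd : barD k G 2 (z - barD k G 3 (pushChain k s 4 w)) = 0 := by
    rw [map_sub, hz, zero_sub, neg_eq_zero]
    exact congrArg (fun φ => φ.hom (pushChain k s 4 w))
      (inhomogeneousChains.d_comp_d (Rep.trivial k G k) (n := 2))
  have hh := barD_homotopy3 k (hBA.trans hc) (z - barD k G 3 (pushChain k s 4 w))
  rw [hT, hd, map_zero, add_zero, smul_zero, zero_sub] at hh
  refine ⟨Nat.card B ^ 4, fun h => hcard ℓ hℓ hℓt (hℓ.dvd_of_dvd_pow h),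
    (Fintype.card B : k) ^ 4 • pushChain k s 4 w -
      homotopy3 k B (z - barD k G 3 (pushChain k s 4 w)), ?_⟩
  rw [map_sub, map_smul, hh, Nat.card_eq_fintype_card, ← Nat.cast_smul_eq_nsmul k]
  push_cast
  module

/-- A set-theoretic lift of `z` need not be a cycle, but its boundary dies in Q, so the transfer of
the lift is one. It maps to |B|³ z. -/
theorem exists_smul_cycle (z : (Fin 3 → Q) →₀ k) (hz : barD k Q 2 z = 0) :
    ∃ m : ℕ, ¬ ℓ ∣ m ∧ ∃ y, barD k G 2 y = 0 ∧ pushChain k f 3 y = m • z := by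
  obtain ⟨s, hs⟩ := hf.hasRightInverse
  have hker : pushChain k f 2 (barD k G 2 (pushChain k s 3 z)) = 0 := by
    rw [← barD_pushChain, pushChain_section k hs, hz]
  obtain ⟨S, hS, hSA, hL⟩ := exists_finite_of_pushChain_eq_zero k hf _ hker
  obtain ⟨B, hB, hBA, hSB, hcard⟩ := exists_finite_subgroup hc ht hft hS hSA
  have := Fintype.ofFinite B
  have hT := hL (transfer2 k B) fun x y h => transfer2_single_eq k B fun i => hSB (h i)
  refine ⟨Nat.card B ^ 3, fun h => hcard ℓ hℓ hℓt (hℓ.dvd_of_dvd_pow h),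
    transfer3 k B (pushChain k s 3 z), ?_, ?_⟩
  · rw [barD_transfer3 k (hBA.trans hc), hT, smul_zero]
  · rw [pushChain_transfer3 k B hBA, pushChain_section k hs, Nat.card_eq_fintype_card,
      ← Nat.cast_smul_eq_nsmul k]
    push_cast
    rfl

end CentralExtension

/-! ### From chains to homology and localization -/

section Homology

theorem homologyπ_eq_zero_iff {R : Type u} [Ring R] {ι : Type v} {c : ComplexShape ι}
    (K : HomologicalComplex (ModuleCat.{u} R) c) {i j : ι} (hij : c.prev j = i) (y : K.cycles j) :
    K.homologyπ j y = 0 ↔ ∃ w : K.X i, K.d i j w = K.iCycles j y := by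
  subst hij
  have hι : Function.Injective (K.homologyι j) := (ModuleCat.mono_iff_injective _).1 inferInstance
  rw [← map_eq_zero_iff _ hι]
  have h : K.homologyι j (K.homologyπ j y) = K.pOpcycles j (K.iCycles j y) :=
    congrArg (fun φ => φ.hom y) (K.homology_π_ι j)
  rw [h]
  exact (K.sc j).moduleCat_pOpcycles_eq_zero_iff _

end Homology

theorem isAwayIso_of_exists {N : ℕ} {A : Type u} {B : Type v} [AddCommGroup A] [AddCommGroup B]
    (f : A →+ B)
    (hker : ∀ ℓ : ℕ, ℓ.Prime → ¬ ℓ ∣ N → ∀ x, f x = 0 → ∃ m : ℕ, ¬ ℓ ∣ m ∧ m • x = 0)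
    (hcoker : ∀ ℓ : ℕ, ℓ.Prime → ¬ ℓ ∣ N → ∀ y, ∃ m : ℕ, ¬ ℓ ∣ m ∧ ∃ x, f x = m • y) :
    IsAwayIso N f := by
  intro ℓ hℓ hN
  have hS (m : ℕ) (hm : ¬ ℓ ∣ m) : (m : ℤ) ∈ (Ideal.span {(ℓ : ℤ)}).primeCompl := by
    change (m : ℤ) ∉ Ideal.span {(ℓ : ℤ)}
    rwa [Ideal.mem_span_singleton, Int.natCast_dvd_natCast]
  have hmap (x : A) (s : (Ideal.span {(ℓ : ℤ)}).primeCompl) :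
      LocalizedModule.map (Ideal.span {(ℓ : ℤ)}).primeCompl f.toIntLinearMap
        (LocalizedModule.mk x s) = LocalizedModule.mk (f x) s :=
    IsLocalizedModule.map_LocalizedModules _ f.toIntLinearMap x s
  constructor
  · rw [injective_iff_map_eq_zero]
    intro x hx
    induction x using LocalizedModule.induction_on with
    | h x s =>
      rw [hmap, ← LocalizedModule.zero_mk s, LocalizedModule.mk_eq] at hx
      obtain ⟨c, hc⟩ := hx
      have h2 : f (((c * s : (Ideal.span {(ℓ : ℤ)}).primeCompl) : ℤ) • x) = 0 := by
        rw [map_zsmul]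
        rw [← mul_smul, smul_zero, smul_zero] at hc
        exact hc
      obtain ⟨m, hm, hmx⟩ := hker ℓ hℓ.out hN _ h2
      rw [← LocalizedModule.zero_mk s, LocalizedModule.mk_eq]
      -- Here `c` clears the equality of fractions in the target, and `m` then kills the resulting
      -- kernel element.
      refine ⟨⟨m, hS m hm⟩ * c, ?_⟩
      rw [← mul_smul, mul_assoc, mul_smul, smul_zero, smul_zero]
      exact (natCast_zsmul _ m).trans hmx
  · intro y
    induction y using LocalizedModule.induction_on with
    | h y s =>
      obtain ⟨m, hm, x, hx⟩ := hcoker ℓ hℓ.out hN y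
      refine ⟨LocalizedModule.mk x (⟨m, hS m hm⟩ * s), ?_⟩
      rw [hmap, hx, ← natCast_zsmul]
      exact LocalizedModule.mk_cancel_common_left
        (⟨(m : ℤ), hS m hm⟩ : (Ideal.span {(ℓ : ℤ)}).primeCompl) s y

/-- A central extension with kernel of exponent `t` induces a `[1/t]`-isomorphism on `H₃`. -/
theorem isAwayIso_H3_of_central {G Q : Type u} [Group G] [Group Q] {f : G →* Q}
    (hf : Function.Surjective f) (hc : f.ker ≤ Subgroup.center G) {t : ℕ} (ht : 0 < t)
    (hft : ∀ c ∈ f.ker, c ^ t = 1) : IsAwayIso t (H.map 3 f) := by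
  have hnext : (ComplexShape.down ℕ).next 3 = 2 := by simp
  have hprev : (ComplexShape.down ℕ).prev 3 = 4 := by simp
  have hdef {G : Type u} [Group G] (n : ℕ) (c : (Fin (n + 1) → G) →₀ IntU.{u}) :
      (inhomogeneousChains (Rep.trivial IntU.{u} G IntU.{u})).d (n + 1) n c = barD IntU G n c := by
    rw [inhomogeneousChains.d_def]; rfl
  have hdi {G : Type u} [Group G] (y : cycles (Rep.trivial IntU.{u} G IntU.{u}) 3) :
      barD IntU G 2 (iCycles _ 3 y) = 0 := by
    rw [← hdef]
    exact congrArg (fun φ => φ.hom y)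
      ((inhomogeneousChains (Rep.trivial IntU.{u} G IntU.{u})).iCycles_d 3 2)
  have hπ (y : cycles (Rep.trivial IntU.{u} G IntU.{u}) 3) :
      H.map 3 f (groupHomology.π _ 3 y) = groupHomology.π _ 3 (cyclesMap f (coeffMap f) 3 y) :=
    groupHomology.π_map_apply f (coeffMap f) 3 y
  have hchain (c : (Fin 3 → G) →₀ IntU.{u}) :
      (chainsMap f (coeffMap f)).f 3 c = pushChain IntU f 3 c := by
    have h : ((chainsMap f (coeffMap f)).f 3).hom = pushChain IntU f 3 :=
      Finsupp.lhom_ext fun g r => by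
        rw [pushChain_single]
        exact chainsMap_f_single f (coeffMap f) 3 g r
    exact DFunLike.congr_fun h c
  have hi (y : cycles (Rep.trivial IntU.{u} G IntU.{u}) 3) :
      iCycles _ 3 (cyclesMap f (coeffMap f) 3 y) = pushChain IntU f 3 (iCycles _ 3 y) := by
    have h1 : iCycles _ 3 (cyclesMap f (coeffMap f) 3 y) =
        (chainsMap f (coeffMap f)).f 3 (iCycles _ 3 y) :=
      congrArg (fun φ => φ.hom y)
        (HomologicalComplex.cyclesMap_i (chainsMap f (coeffMap f)) 3)
    rw [h1]
    exact hchain _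
  refine isAwayIso_of_exists _ (fun ℓ hℓ hℓt x hx => ?_) (fun ℓ hℓ hℓt y => ?_)
  · induction x using groupHomology_induction_on with
    | h x =>
      rw [hπ] at hx
      obtain ⟨w, hw⟩ := (homologyπ_eq_zero_iff _ hprev _).1 hx
      obtain ⟨m, hm, v, hv⟩ := exists_smul_boundary IntU hf hc ht hft hℓ hℓt _ (hdi x) w
        (by rw [← hdef, ← hi]; exact hw)
      refine ⟨m, hm, ?_⟩
      rw [← map_nsmul]
      exact (homologyπ_eq_zero_iff _ hprev _).2 ⟨v, by rw [map_nsmul, ← hv]; exact hdef _ _⟩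
  · induction y using groupHomology_induction_on with
    | h y =>
      obtain ⟨m, hm, x, hx, hxy⟩ := exists_smul_cycle IntU hf hc ht hft hℓ hℓt _ (hdi y)
      refine ⟨m, hm, groupHomology.π _ 3 (cyclesMk 3 2 hnext x ((hdef 2 x).trans hx)), ?_⟩
      rw [hπ, ← map_nsmul]
      congr 1
      refine (ModuleCat.mono_iff_injective (iCycles _ 3)).1 inferInstance ?_
      rw [hi, iCycles_mk, hxy, map_nsmul]

/-! ### Adjoint groups and their action -/

theorem As.hom_ext {X : Type u} [Quandle X] {G : Type v} [Group G] {φ ψ : As X →* G}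
    (h : ∀ x, φ (As.e x) = ψ (As.e x)) : φ = ψ :=
  PresentedGroup.ext h

theorem As.map_e {X : Type u} {Y : Type v} [Quandle X] [Quandle Y] (f : X →◃ Y) (x : X) :
    As.map f (As.e x) = As.e (f x) :=
  As.lift_e _ _ x

theorem As.closure_range_e (X : Type u) [Quandle X] :
    Subgroup.closure (Set.range (As.e : X → As X)) = ⊤ :=
  PresentedGroup.closure_range_of _

/-- An element of `As(X)` acting trivially on `X` is central. -/
theorem As.mem_center_of_ract_eq {X : Type u} [Quandle X] {g : As X} (hg : ∀ x, ract x g = x) :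
    g ∈ Subgroup.center (As X) := by
  have h : Subgroup.centralizer {g} = ⊤ := by
    rw [eq_top_iff, ← As.closure_range_e, Subgroup.closure_le]
    rintro _ ⟨x, rfl⟩
    have hx := As.e_ract g x
    rw [hg, eq_comm, mul_assoc, inv_mul_eq_iff_eq_mul] at hx
    exact Subgroup.mem_centralizer_singleton_iff.2 hx
  exact Subgroup.mem_center_iff.2 fun x =>
    (Subgroup.mem_centralizer_singleton_iff.1 (h.symm ▸ Subgroup.mem_top x : x ∈ _))

theorem ract_e_pow {X : Type u} [Quandle X] (x y : X) (n : ℕ) :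
    ract x (As.e y ^ n) = (fun z => lhd z y)^[n] x := by
  induction n with
  | zero => simp
  | succ n ih => rw [pow_succ, ract_mul, ih, ract_e, Function.iterate_succ_apply']

theorem ract_zpow_self {X : Type u} [Quandle X] (a : X) (n : ℤ) : ract a (As.e a ^ n) = a := by
  let S : Subgroup (As X) :=
    { carrier := {g | ract a g = a}
      one_mem' := ract_one a
      mul_mem' := fun {g h} hg hh => by
        change ract a (g * h) = a
        rw [ract_mul, show ract a g = a from hg, hh]
      inv_mem' := fun {g} hg => by
        change ract a g⁻¹ = a
        conv_lhs => rw [← show ract a g = a from hg]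
        rw [← ract_mul, mul_inv_cancel, ract_one] }
  have h : As.e a ∈ S := by
    change ract a (As.e a) = a
    rw [ract_e, lhd, Quandle.fix]
  exact S.zpow_mem h n

theorem As.eps_map {X : Type u} {Y : Type v} [Quandle X] [Quandle Y] (f : X →◃ Y) (g : As X) :
    As.eps Y (As.map f g) = As.eps X g := by
  have h : (As.eps Y).comp (As.map f) = As.eps X :=
    As.hom_ext fun x => by rw [MonoidHom.comp_apply, As.map_e, As.eps_e, As.eps_e]
  exact DFunLike.congr_fun h g

/-- The `n`-th power of `e_x` is central if the `n`-fold operation of `x` is trivial. -/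
theorem As.e_pow_mem_center {X : Type u} [Quandle X] {n : ℕ} {x : X}
    (h : ∀ z : X, (fun z => lhd z x)^[n] z = z) : As.e x ^ n ∈ Subgroup.center (As X) :=
  As.mem_center_of_ract_eq fun z => by rw [ract_e_pow, h]

/-! ### The kernel of p_* -/

namespace UnivCover

variable {X : Type u} [Quandle X] {a : X}

theorem proj_apply (g : UnivCover X a) : proj X a g = ract a g.val := rfl

theorem val_lhd (g h : UnivCover X a) :
    (lhd g h).val = (As.e a)⁻¹ * g.val * As.e (proj X a h) := by
  change (op g h).val = _
  rw [val_op, proj_apply, As.e_ract]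
  group

theorem proj_surjective (hX : IsConnected X) : Function.Surjective (proj X a) := by
  intro x
  obtain ⟨g, hg⟩ := hX.2 a x
  -- Powers of e_a fix a, so this prefix brings `g` into Ker(ε) without changing a · g.
  refine ⟨⟨As.e a ^ (-(As.eps X g).toAdd) * g, ?_⟩, ?_⟩
  · rw [MonoidHom.mem_ker, map_mul, map_zpow, As.eps_e]
    apply Multiplicative.toAdd.injective
    simp
  · change ract a (As.e a ^ (-(As.eps X g).toAdd) * g) = x
    rw [ract_mul, ract_zpow_self, hg]

theorem map_proj_surjective (hX : IsConnected X) :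
    Function.Surjective (As.map (proj X a)) := by
  rw [← MonoidHom.range_eq_top, eq_top_iff, ← As.closure_range_e, Subgroup.closure_le]
  rintro _ ⟨x, rfl⟩
  obtain ⟨g, rfl⟩ := proj_surjective (a := a) hX x
  exact ⟨As.e g, As.map_e _ _⟩

/-- The action of `As(X̃)` on `X̃` is `x · g = e_a^{-ε(g)} x p_*(g)`. -/
theorem val_ract (g : As (UnivCover X a)) (x : UnivCover X a) :
    (ract x g).val =
      As.e a ^ (-(As.eps (UnivCover X a) g).toAdd) * x.val * As.map (proj X a) g := by
  let S : Subgroup (As (UnivCover X a)) :=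
    { carrier := {g | ∀ x : UnivCover X a, (ract x g).val =
        As.e a ^ (-(As.eps (UnivCover X a) g).toAdd) * x.val * As.map (proj X a) g}
      one_mem' := fun x => by simp
      mul_mem' := fun {g h} hg hh x => by
        rw [ract_mul, hh, hg, MonoidHom.map_mul, MonoidHom.map_mul, toAdd_mul, neg_add_rev, zpow_add]
        group
      inv_mem' := fun {g} hg x => by
        have h := hg (ract x g⁻¹)
        rw [← ract_mul, inv_mul_cancel, ract_one] at h
        rw [MonoidHom.map_inv, MonoidHom.map_inv, toAdd_inv, h]
        group }
  have hS : S = ⊤ := by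
    rw [eq_top_iff, ← As.closure_range_e, Subgroup.closure_le]
    rintro _ ⟨y, rfl⟩ x
    rw [ract_e, val_lhd, As.eps_e, As.map_e, toAdd_ofAdd, zpow_neg_one]
  exact (hS ▸ Subgroup.mem_top g : g ∈ S) x

theorem ker_map_proj_le_center :
    (As.map (proj X a)).ker ≤ Subgroup.center (As (UnivCover X a)) := by
  intro g hg
  rw [MonoidHom.mem_ker] at hg
  refine As.mem_center_of_ract_eq fun x => ext ?_
  rw [val_ract, hg, ← As.eps_map (proj X a), hg]
  simp

theorem isConnected (hX : IsConnected X) (x y : UnivCover X a) : ∃ g, ract x g = y := by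
  obtain ⟨g, hg⟩ := map_proj_surjective (a := a) hX (x.val⁻¹ * y.val)
  refine ⟨g, ext ?_⟩
  rw [val_ract, hg, ← As.eps_map (proj X a), hg]
  simp [eps_val]

/-- In As(X) the central power e_a^t equals its conjugate e_{p(g)}^t, so e_g^t sends x to e_a^{-t} x
e_a^t = x. -/
theorem e_pow_mem_center {t : ℕ} (ht : IsOfType X t) (g : UnivCover X a) :
    As.e g ^ t ∈ Subgroup.center (As (UnivCover X a)) := by
  refine As.mem_center_of_ract_eq fun x => ext ?_
  have h (y : X) := Subgroup.mem_center_iff.1 (As.e_pow_mem_center fun z => ht.1.2 z y)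
  have he : As.e (proj X a g) ^ t = As.e a ^ t := by
    rw [proj_apply, As.e_ract]
    have h2 := h a g.val
    have : (g.val⁻¹ * As.e a * g.val) ^ t = g.val⁻¹ * As.e a ^ t * g.val := by
      simpa using (conj_pow (i := t) (a := g.val⁻¹) (b := As.e a))
    rw [this, mul_assoc, ← h2, inv_mul_cancel_left]
  rw [val_ract, MonoidHom.map_pow, MonoidHom.map_pow, As.eps_e, As.map_e, he, mul_assoc, h a]
  simp [← mul_assoc, ← zpow_natCast]

theorem e_pow_eq (hX : IsConnected X) {t : ℕ} (ht : IsOfType X t) (g h : UnivCover X a) :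
    As.e g ^ t = As.e h ^ t := by
  obtain ⟨y, rfl⟩ := isConnected hX g h
  have h2 := Subgroup.mem_center_iff.1 (e_pow_mem_center ht g) y
  have h3 : (y⁻¹ * As.e g * y) ^ t = y⁻¹ * As.e g ^ t * y := by
    simpa using (conj_pow (i := t) (a := y⁻¹) (b := As.e g))
  rw [As.e_ract, h3, mul_assoc, ← h2, inv_mul_cancel_left]

theorem pow_eq_one_of_mem_ker (hX : IsConnected X) {t : ℕ} (ht : IsOfType X t)
    {c : As (UnivCover X a)} (hc : c ∈ (As.map (proj X a)).ker) : c ^ t = 1 := by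
  have hcomm {c : As (UnivCover X a)} (hc : c ∈ (As.map (proj X a)).ker)
      (g : As (UnivCover X a)) : g * c = c * g :=
    Subgroup.mem_center_iff.1 (ker_map_proj_le_center hc) g
  -- It suffices that the quotient map by this subgroup factors through p_*, since then Ker(p_*) ≤
  -- `M`.
  let M : Subgroup (As (UnivCover X a)) :=
    { carrier := {c | c ∈ (As.map (proj X a)).ker ∧ c ^ t = 1}
      one_mem' := ⟨one_mem _, one_pow t⟩
      mul_mem' := fun {c d} hc hd => ⟨mul_mem hc.1 hd.1, by
        rw [(show Commute c d from hcomm hd.1 c).mul_pow, hc.2, hd.2, one_mul]⟩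
      inv_mem' := fun {c} hc => ⟨inv_mem hc.1, by rw [inv_pow, hc.2, inv_one]⟩ }
  have : M.Normal := ⟨fun c hc g => by
    rw [hcomm hc.1 g, mul_inv_cancel_right]; exact hc⟩
  have hfib {g h : UnivCover X a} (hgh : proj X a g = proj X a h) :
      (QuotientGroup.mk' M) (As.e g) = (QuotientGroup.mk' M) (As.e h) := by
    have hk : (As.e g)⁻¹ * As.e h ∈ (As.map (proj X a)).ker := by
      rw [MonoidHom.mem_ker, map_mul, map_inv, As.map_e, As.map_e, hgh, inv_mul_cancel]
    refine QuotientGroup.eq.2 ⟨hk, ?_⟩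
    -- Writing e_h = e_g c with c central gives e_h^t = e_g^t c^t; the two t-th powers agree, so c^t
    -- = 1.
    have h1 : As.e g * ((As.e g)⁻¹ * As.e h) = As.e h := mul_inv_cancel_left _ _
    have h2 := (show Commute (As.e g) ((As.e g)⁻¹ * As.e h) from hcomm hk _).mul_pow t
    rw [h1, e_pow_eq hX ht h g] at h2
    exact left_eq_mul.1 h2
  obtain ⟨s, hs⟩ := (proj_surjective (a := a) hX).hasRightInverse
  -- By `hfib` the class of a generator depends only on its image in X, so any section `s` of p
  -- respects the relations.
  let σ : As X →* As (UnivCover X a) ⧸ M :=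
    As.lift (fun x => QuotientGroup.mk' M (As.e (s x))) fun x y => by
      rw [← map_inv, ← map_mul, ← map_mul, ← As.e_lhd]
      refine hfib ?_
      rw [hs]
      conv_lhs => rw [← hs x, ← hs y]
      exact (ShelfHom.map_act (proj X a)).symm
  have hσ : σ.comp (As.map (proj X a)) = QuotientGroup.mk' M := As.hom_ext fun g => by
    rw [MonoidHom.comp_apply, As.map_e, As.lift_e]
    exact hfib (hs _)
  have hcM : c ∈ M := by
    rw [← QuotientGroup.ker_mk' M, ← hσ, MonoidHom.mem_ker, MonoidHom.comp_apply,
      MonoidHom.mem_ker.1 hc, map_one]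
  exact hcM.2

end UnivCover

end QuandleCovering

end

theorem proposition5p5 {X : Type*} [Quandle X] (hX : QuandleCovering.IsConnected X)
    (t : ℕ) (ht : QuandleCovering.IsOfType X t) (a : X) :
    QuandleCovering.IsAwayIso t
      (QuandleCovering.H.map 3 (QuandleCovering.As.map (QuandleCovering.UnivCover.proj X a))) :=
  QuandleCovering.isAwayIso_H3_of_central (QuandleCovering.UnivCover.map_proj_surjective hX)
    QuandleCovering.UnivCover.ker_map_proj_le_center ht.1.1
    fun _ hc => QuandleCovering.UnivCover.pow_eq_one_of_mem_ker hX ht hc
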